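/- Let $S\in\mathbb N$ and let $\lambda,\mu,\xi:[0,\infty)\to[0,\infty)$ be locally integrable. Consider the $M_t|M_t|S$ queue with catastrophes: its queue-length process $X(t)$, $t\ge 0$, is the inhomogeneous continuous-time Markov chain on $\{0,1,2,\dots\}$ that jumps from $k$ to $k+1$ at rate $\lambda(t)$ and, for $k\ge1$, from $k$ to $k-1$ at rate $\min(k,S)\mu(t)$ and from $k$ to $0$ at the catastrophe rate $\xi_k(t)=\zeta_k\xi(t)$. Let $A(t)=(a_{ij}(t))$ be its transposed intensity matrix, and assume that for some $L<\infty$, $|a_{kk}(t)|\le L$ for almost all $t\ge0$ and all $k$. The state probabilities solve the forward Kolmogorov system $\frac{d\mathbf p}{dt}=A(t)\mathbf p$ in $l_1$ (understood in the integrated sense). Suppose that $$\inf_{n\ge1}\zeta_n=\zeta>0,\qquad \int_0^\infty\bigl(\zeta\xi(t)-\varepsilon\lambda(t)\bigr)\,dt=+\infty\ \text{ for some }\varepsilon>0 .$$ Let $\mathbf p(t)$ and $\pi(t)$ be the distributions of $X(t)$ given $X(0)=k$ and $X(0)=0$ respectively, and let $E_k(t)=E\{X(t)\mid X(0)=k\}$.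 Then: 1. $X(t)$ is weakly ergodic: $\|\mathbf p^*(t)-\mathbf p^{**}(t)\|_{l_1}\to0$ as $t\to\infty$ for any two solutions of the forward Kolmogorov system in $l_1$ whose initial values are probability vectors. 2. All means $E_k(t)$ are finite, and $\phi(t)=E_0(t)$ is a limiting mean: $\phi(t)-E_k(t)\to0$ as $t\to\infty$ for every $k$. 3. For all $k\ge0$ and $t\ge0$, $$\|\mathbf p(t)-\pi(t)\|_{l_1}\le 4(1+\varepsilon)^k\varepsilon^{-1}e^{-\int_0^t(\zeta\xi(\tau)-\varepsilon\lambda(\tau))\,d\tau},$$ $$|E_k(t)-E_0(t)|\le\frac{4(1+\varepsilon)^k}{\varepsilon W}\,e^{-\int_0^t(\zeta\xi(\tau)-\varepsilon\lambda(\tau))\,d\tau},\qquad W=\inf_{i\ge1}\frac{(1+\varepsilon)^{i-1}}{i}.$$ If $\varepsilon\le4$, the last bound also holds with the larger constant $W=\inf_{i\ge1}\frac{(1+\varepsilon)^{i}}{i}$. -/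

import Mathlib

open MeasureTheory Filter Topology

/-- The sequence space `l₁` with its usual norm `‖x‖ = ∑ |x i|`. -/
abbrev SeqL1 : Type := lp (fun _ : ℕ => ℝ) 1

/-- Stochastic vectors: the elements of `l₁` with nonnegative coordinates and unit norm. -/
def IsStochasticVector (x : SeqL1) : Prop :=
  (∀ i, 0 ≤ x i) ∧ ‖x‖ = 1

/-- The transposed intensity matrix `A(t)` of a birth-death-catastrophe process: the entry `(i, j)`
with `i ≠ j` is the rate of the jump from state `j` to state `i`. From state `j` the process jumps
to `j + 1` at rate `lam j t` and, if `j ≥ 1`, to `j - 1` at rate `mu j t` (service) and to `0` at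
rate `xi j t` (catastrophe). Every column sums to zero. -/
def bdcMatrix (lam mu xi : ℕ → ℝ → ℝ) (t : ℝ) (i j : ℕ) : ℝ :=
  if i = j then -(lam j t + if j = 0 then 0 else mu j t + xi j t)
  else (if i = j + 1 then lam j t else 0) + (if j = i + 1 then mu j t else 0)
    + (if i = 0 then xi j t else 0)

/-- The transposed intensity matrix of the `M_t|M_t|S` queue with catastrophes: arrival rate
`lam t`, service rates `min(k, S) * mu t`, catastrophe rates `zeta k * xi t` (for `k ≥ 1`). -/
def queueMatrix (S : ℕ) (lam mu : ℝ → ℝ) (zeta : ℕ → ℝ) (xi : ℝ → ℝ) :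
    ℝ → ℕ → ℕ → ℝ :=
  bdcMatrix (fun _ t => lam t) (fun k t => ((min k S : ℕ) : ℝ) * mu t) (fun k t => zeta k * xi t)

/-- `p` solves the forward Kolmogorov system `dp/dt = A(t) p(t)` in `l₁` on `[s, ∞)`. As the
coefficients are only locally integrable, the equation is meant in integrated form. -/
def IsForwardSolution (A : ℝ → ℕ → ℕ → ℝ) (s : ℝ) (p : ℝ → SeqL1) : Prop :=
  ContinuousOn p (Set.Ici s) ∧
    ∀ t, s ≤ t → ∀ i : ℕ,
      IntervalIntegrable (fun τ => ∑' j, A τ i j * p τ j) volume s t ∧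
        p t i = p s i + ∫ τ in s..t, ∑' j, A τ i j * p τ j

/-- Under `P`, the `ℕ`-valued process `(X t)` for `t ≥ 0` is an inhomogeneous continuous-time
Markov chain with transposed intensity matrix `A`: its finite-dimensional distributions are given
by transition probabilities `p_{ij}(s, t) = tr s i t j` such that for all `s ≥ 0` and all `i` the
function `t ↦ (p_{ij}(s, t))_j` solves the forward Kolmogorov system on `[s, ∞)` and starts at time
`s` from the unit vector `e_i`. The initial distribution is arbitrary. -/
def IsMarkovChainWithIntensity (A : ℝ → ℕ → ℕ → ℝ) {Ω : Type*} [MeasurableSpace Ω]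
    (P : Measure Ω) (X : ℝ → Ω → ℕ) : Prop :=
  (∀ t, 0 ≤ t → Measurable (X t)) ∧
    ∃ tr : ℝ → ℕ → ℝ → SeqL1,
      (∀ s, 0 ≤ s → ∀ i,
        IsForwardSolution A s (tr s i) ∧ ∀ j, tr s i s j = if j = i then 1 else 0) ∧
      ∀ (n : ℕ) (t : ℕ → ℝ) (x : ℕ → ℕ), 0 ≤ t 0 → Monotone t →
        P.real {ω | ∀ m ≤ n, X (t m) ω = x m} =
          P.real {ω | X (t 0) ω = x 0} *
            ∏ m ∈ Finset.range n, tr (t m) (x m) (t (m + 1)) (x (m + 1))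

/-- Weak ergodicity of the chain with transposed intensity matrix `A`: any two solutions of the
forward Kolmogorov system with stochastic initial conditions approach each other in `l₁`. -/
def IsWeaklyErgodic (A : ℝ → ℕ → ℕ → ℝ) : Prop :=
  ∀ p q : ℝ → SeqL1, IsForwardSolution A 0 p → IsForwardSolution A 0 q →
    IsStochasticVector (p 0) → IsStochasticVector (q 0) →
      Tendsto (fun t => ‖p t - q t‖) atTop (𝓝 0)

/-- The state probability `Pr{X(t) = i}` under `P`. -/
noncomputable def stateProb {Ω : Type*} [MeasurableSpace Ω] (P : Measure Ω) (X : ℝ → Ω → ℕ)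
    (t : ℝ) (i : ℕ) : ℝ :=
  P.real {ω | X t ω = i}

/-- The mean of `X(t)` under `P`. -/
noncomputable def meanAt {Ω : Type*} [MeasurableSpace Ω] (P : Measure Ω) (X : ℝ → Ω → ℕ)
    (t : ℝ) : ℝ :=
  ∫ ω, (X t ω : ℝ) ∂P

/-- `φ` is a limiting mean, where `E k t` is the mean at time `t` for the initial state `k`. -/
def IsLimitingMean (E : ℕ → ℝ → ℝ) (φ : ℝ → ℝ) : Prop :=
  ∀ k, Tendsto (fun t => φ t - E k t) atTop (𝓝 0)

/-- `W = inf_{i ≥ 1} d_i / i`. -/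
noncomputable def growthConst (d : ℕ → ℝ) : ℝ :=
  ⨅ i : ℕ, d (i + 1) / ((i : ℝ) + 1)

/-! The difference y of two solutions with equal mass keeps total mass zero, so z ξ ∑ y_j may be
subtracted from its zeroth equation. The catastrophe coefficients then drop to ζ_j ξ - z ξ ≥ 0 for j
≥ 1, and all off-diagonal coefficients stay nonnegative. For increasing weights w with w_{i+1} ≤
(1+e) w_i, each weighted column sum is at most (e λ - z ξ) times its own weight: a birth gains at
most e λ, while deaths and the remaining catastrophes only lower the weight. Hence ∑ w_i max(y_i, 0)
has logarithmic growth rate at most e λ - z ξ (`tsum_weighted_bdcRow_le`, `tsum_weight_mul_max_le`).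

Constant weights with e = 0 make the l₁ norm decay like exp(-∫ z ξ), which gives weak ergodicity and
the norm bound. The weights (1+ε)^i control the positive part of the difference of the means;
exchanging the two solutions controls the negative part. They are unbounded, so they are truncated
at N and the estimate is made uniform in N (`sum_pow_mul_max_le`); no weighted sequence space is
needed. The same estimate with z replaced by 0 and e = 1, where no mass condition is required, shows
that the means are finite. -/

/-! ### Absolutely continuous functions, Grönwall, termwise integration -/

theorem LipschitzOnWith.comp_absolutelyContinuousOnInterval {f φ : ℝ → ℝ} {a b : ℝ} {K : NNReal}
    (hφ : LipschitzOnWith K φ (f '' Set.uIcc a b)) (hf : AbsolutelyContinuousOnInterval f a b) :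
    AbsolutelyContinuousOnInterval (fun t => φ (f t)) a b := by
  rw [absolutelyContinuousOnInterval_iff] at hf ⊢
  intro ε hε
  obtain ⟨δ, hδ, h⟩ := hf (ε / (K + 1)) (by positivity)
  refine ⟨δ, hδ, fun E hE hlen => ?_⟩
  calc ∑ i ∈ Finset.range E.1, dist (φ (f (E.2 i).1)) (φ (f (E.2 i).2))
      ≤ ∑ i ∈ Finset.range E.1, K * dist (f (E.2 i).1) (f (E.2 i).2) := by
        refine Finset.sum_le_sum fun i hi => ?_
        have := hE.1 i hi
        exact hφ.dist_le_mul _ (Set.mem_image_of_mem _ this.1) _ (Set.mem_image_of_mem _ this.2)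
    _ ≤ (K + 1) * ∑ i ∈ Finset.range E.1, dist (f (E.2 i).1) (f (E.2 i).2) := by
        rw [← Finset.mul_sum]
        gcongr
        linarith
    _ < ε := by
        have := h E hE hlen
        rw [lt_div_iff₀ (by positivity)] at this
        linarith

theorem AbsolutelyContinuousOnInterval.of_eq_add_integral {u g : ℝ → ℝ} {a b : ℝ} (hab : a ≤ b)
    (hg : IntervalIntegrable g volume a b)
    (hu : ∀ t ∈ Set.Icc a b, u t = u a + ∫ τ in a..t, g τ) :
    AbsolutelyContinuousOnInterval u a b := by
  have h1 := hg.absolutelyContinuousOnInterval_intervalIntegral (c := a) (by simp)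
  have h2 : AbsolutelyContinuousOnInterval (fun _ : ℝ => u a) a b :=
    (LipschitzWith.const (u a)).lipschitzOnWith.absolutelyContinuousOnInterval (K := 0)
  have h3 := h2.fun_add h1
  rw [absolutelyContinuousOnInterval_iff] at h3 ⊢
  intro ε hε
  obtain ⟨δ, hδ, h⟩ := h3 ε hε
  refine ⟨δ, hδ, fun E hE hlen => ?_⟩
  convert h E hE hlen using 1
  refine Finset.sum_congr rfl fun i hi => ?_
  have := hE.1 i hi
  rw [Set.uIcc_of_le hab] at this
  rw [hu _ this.1, hu _ this.2]

theorem ae_hasDerivAt_of_eq_add_integral {u g : ℝ → ℝ} {a b : ℝ} (hab : a ≤ b)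
    (hg : IntervalIntegrable g volume a b)
    (hu : ∀ t ∈ Set.Icc a b, u t = u a + ∫ τ in a..t, g τ) :
    ∀ᵐ t, t ∈ Set.Ioo a b → HasDerivAt u (g t) t := by
  filter_upwards [hg.ae_hasDerivAt_integral] with t ht htab
  rw [Set.uIcc_of_le hab] at ht
  have h1 := (ht (Set.Ioo_subset_Icc_self htab) a (Set.left_mem_Icc.2 hab)).const_add (u a)
  refine h1.congr_of_eventuallyEq ?_
  filter_upwards [Ioo_mem_nhds htab.1 htab.2] with s hs
  exact hu s (Set.Ioo_subset_Icc_self hs)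

theorem ae_mem_Ioo_of_mem_uIoc {a b : ℝ} (hab : a ≤ b) :
    ∀ᵐ t : ℝ, t ∈ Set.uIoc a b → t ∈ Set.Ioo a b := by
  have h : ∀ᵐ t : ℝ, t ≠ b := by simp [ae_iff, measure_singleton]
  filter_upwards [h] with t ht htab
  rw [Set.uIoc_of_le hab] at htab
  exact ⟨htab.1, lt_of_le_of_ne htab.2 ht⟩

/-- The positive part of an integral function is the integral of the derivative restricted to the
set where the function is positive. -/
theorem max_zero_eq_add_integral {x f : ℝ → ℝ} {a b : ℝ} (hab : a ≤ b)
    (hf : IntervalIntegrable f volume a b)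
    (hx : ∀ t ∈ Set.Icc a b, x t = x a + ∫ τ in a..t, f τ) :
    IntervalIntegrable (fun τ => if 0 < x τ then f τ else 0) volume a b ∧
      max (x b) 0 = max (x a) 0 + ∫ τ in a..b, if 0 < x τ then f τ else 0 := by
  have hac := AbsolutelyContinuousOnInterval.of_eq_add_integral hab hf hx
  have hlip : LipschitzWith 1 (fun y : ℝ => max y 0) := LipschitzWith.id.max_const 0
  have hpac : AbsolutelyContinuousOnInterval (fun t => max (x t) 0) a b :=
    hlip.lipschitzOnWith.comp_absolutelyContinuousOnInterval hac
  have hderiv : ∀ᵐ t, t ∈ Set.uIoc a b →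
      deriv (fun t => max (x t) 0) t = if 0 < x t then f t else 0 := by
    filter_upwards [ae_hasDerivAt_of_eq_add_integral hab hf hx, ae_mem_Ioo_of_mem_uIoc hab]
      with t ht htab hmem
    have hd := ht (htab hmem)
    rcases lt_trichotomy (x t) 0 with hneg | hzero | hpos
    · rw [if_neg hneg.not_gt]
      have : (fun t => max (x t) 0) =ᶠ[𝓝 t] fun _ => 0 := by
        filter_upwards [hd.continuousAt.eventually_lt_const hneg] with s hs
        exact max_eq_right hs.le
      rw [this.deriv_eq]
      simp
    · rw [if_neg (by rw [hzero]; exact lt_irrefl _)]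
      -- The positive part is minimal at a zero of `x`, so `deriv` is 0 there whatever `f t` is; at
      -- a kink this is its default value.
      refine IsLocalMin.deriv_eq_zero (Eventually.of_forall fun s => ?_)
      simp [hzero]
    · rw [if_pos hpos]
      have : (fun t => max (x t) 0) =ᶠ[𝓝 t] x := by
        filter_upwards [hd.continuousAt.eventually_const_lt hpos] with s hs
        exact max_eq_left hs.le
      rw [this.deriv_eq, hd.deriv]
  refine ⟨hpac.intervalIntegrable_deriv.congr_ae ?_, ?_⟩
  · rwa [EventuallyEq, ae_restrict_iff' measurableSet_uIoc]
  · have h := hpac.integral_deriv_eq_sub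
    rw [intervalIntegral.integral_congr_ae hderiv] at h
    linarith

/-- Grönwall's inequality for integral functions, with an integrable rate of arbitrary sign. -/
theorem le_mul_exp_integral {u g c : ℝ → ℝ} {a b : ℝ} (hab : a ≤ b)
    (hg : IntervalIntegrable g volume a b) (hc : IntervalIntegrable c volume a b)
    (hu : ∀ t ∈ Set.Icc a b, u t = u a + ∫ τ in a..t, g τ)
    (hle : ∀ᵐ t, t ∈ Set.Ioo a b → g t ≤ c t * u t) :
    u b ≤ u a * Real.exp (∫ τ in a..b, c τ) := by
  set C : ℝ → ℝ := fun t => ∫ τ in a..t, c τ with hC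
  have hC0 : C a = 0 := intervalIntegral.integral_same
  have hCeq : ∀ t ∈ Set.Icc a b, C t = C a + ∫ τ in a..t, c τ := fun t _ => by rw [hC0, zero_add]
  have huac := AbsolutelyContinuousOnInterval.of_eq_add_integral hab hg hu
  have hCac := AbsolutelyContinuousOnInterval.of_eq_add_integral hab hc hCeq
  -- The exponential is only locally Lipschitz, but `C` is bounded on the interval.
  have hEac : AbsolutelyContinuousOnInterval (fun t => Real.exp (-C t)) a b := by
    obtain ⟨R, hR⟩ := hCac.exists_bound
    have hsm : ContDiffOn ℝ 1 (fun y : ℝ => Real.exp (-y)) (Set.Icc (-R) R) := by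
      fun_prop
    obtain ⟨K, hK⟩ := hsm.exists_lipschitzOnWith (by decide) (convex_Icc _ _) isCompact_Icc
    refine (hK.mono ?_).comp_absolutelyContinuousOnInterval hCac
    rintro _ ⟨t, ht, rfl⟩
    exact abs_le.1 (hR t ht)
  have hv := (huac.fun_mul hEac).integral_deriv_eq_sub
  -- Integrating factor: the a.e. derivative (g - c u) e^{-C} is nonpositive.
  have hnonpos : ∫ t in a..b, deriv (fun t => u t * Real.exp (-C t)) t ≤ 0 := by
    have : ∫ t in a..b, deriv (fun t => u t * Real.exp (-C t)) t ≤ ∫ t in a..b, (0 : ℝ) := by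
      refine intervalIntegral.integral_mono_ae_restrict hab
        (huac.fun_mul hEac).intervalIntegrable_deriv (by simp) ?_
      rw [EventuallyLE, ae_restrict_iff' measurableSet_Icc]
      have ha : ∀ᵐ t : ℝ, t ≠ a := by simp [ae_iff, measure_singleton]
      have hb : ∀ᵐ t : ℝ, t ≠ b := by simp [ae_iff, measure_singleton]
      filter_upwards [ae_hasDerivAt_of_eq_add_integral hab hg hu,
        ae_hasDerivAt_of_eq_add_integral hab hc hCeq, hle, ha, hb] with t h1 h2 h3 h4 h5 hmem
      have hmem' : t ∈ Set.Ioo a b := ⟨lt_of_le_of_ne hmem.1 h4.symm, lt_of_le_of_ne hmem.2 h5⟩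
      rw [((h1 hmem').fun_mul (h2 hmem').fun_neg.exp).deriv]
      have := mul_le_mul_of_nonneg_right (h3 hmem') (Real.exp_pos (-C t)).le
      linarith
    simpa using this
  rw [hv, hC0] at hnonpos
  simp only [neg_zero, Real.exp_zero, mul_one, Real.exp_neg] at hnonpos
  have hpos := Real.exp_pos (C b)
  have : u b * (Real.exp (C b))⁻¹ ≤ u a := by linarith
  rwa [← div_eq_mul_inv, div_le_iff₀ hpos] at this

/-- Termwise integration of a series of integral functions whose derivatives have uniformly bounded
partial sums. -/
theorem tsum_eq_add_integral_tsum {H G : ℕ → ℝ → ℝ} {a b B : ℝ} (hab : a ≤ b)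
    (hG : ∀ i, IntervalIntegrable (G i) volume a b)
    (hH : ∀ i, H i b = H i a + ∫ τ in a..b, G i τ)
    (hsum : ∀ᵐ t, t ∈ Set.Ioo a b → Summable fun i => G i t)
    (hbound : ∀ᵐ t, t ∈ Set.Ioo a b → ∀ N, |∑ i ∈ Finset.range N, G i t| ≤ B)
    (ha : Summable fun i => H i a) (hb : Summable fun i => H i b) :
    IntervalIntegrable (fun τ => ∑' i, G i τ) volume a b ∧
      ∑' i, H i b = ∑' i, H i a + ∫ τ in a..b, ∑' i, G i τ := by
  have hmeas : ∀ N, AEStronglyMeasurable (fun t => ∑ i ∈ Finset.range N, G i t)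
      (volume.restrict (Set.uIoc a b)) := fun N =>
    Finset.aestronglyMeasurable_fun_sum _ fun i _ =>
      (intervalIntegrable_iff.1 (hG i)).aestronglyMeasurable
  have hlim : ∀ᵐ t, t ∈ Set.uIoc a b →
      Tendsto (fun N => ∑ i ∈ Finset.range N, G i t) atTop (𝓝 (∑' i, G i t)) := by
    filter_upwards [hsum, ae_mem_Ioo_of_mem_uIoc hab] with t h1 h2 hmem
    exact (h1 (h2 hmem)).hasSum.tendsto_sum_nat
  have hbd : ∀ᵐ t, t ∈ Set.uIoc a b → ∀ N, ‖∑ i ∈ Finset.range N, G i t‖ ≤ B := by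
    filter_upwards [hbound, ae_mem_Ioo_of_mem_uIoc hab] with t h1 h2 hmem
    exact h1 (h2 hmem)
  have hint := intervalIntegral.tendsto_integral_filter_of_dominated_convergence
    (μ := volume) (l := atTop) (fun _ => B) (Eventually.of_forall hmeas)
    (Eventually.of_forall fun N => by
      filter_upwards [hbd] with t h1 hmem using h1 hmem N) intervalIntegrable_const hlim
  refine ⟨?_, ?_⟩
  · rw [intervalIntegrable_iff]
    refine Integrable.mono' (g := fun _ => B) (intervalIntegrable_iff.1 intervalIntegrable_const)
      (aestronglyMeasurable_of_tendsto_ae atTop hmeas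
        ((ae_restrict_iff' measurableSet_uIoc).2 hlim)) ?_
    rw [ae_restrict_iff' measurableSet_uIoc]
    filter_upwards [hlim, hbd] with t h1 h2 hmem
    exact le_of_tendsto (h1 hmem).norm (Eventually.of_forall (h2 hmem))
  · have h1 : ∀ N, ∫ τ in a..b, ∑ i ∈ Finset.range N, G i τ
        = ∑ i ∈ Finset.range N, H i b - ∑ i ∈ Finset.range N, H i a := fun N => by
      rw [intervalIntegral.integral_finsetSum fun i _ => hG i, ← Finset.sum_sub_distrib]
      exact Finset.sum_congr rfl fun i _ => by rw [hH i]; ring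
    simp only [h1] at hint
    have := tendsto_nhds_unique hint (hb.hasSum.tendsto_sum_nat.sub ha.hasSum.tendsto_sum_nat)
    linarith

/-! ### The forward vector field at a fixed time -/

theorem HasSum.pred {h : ℕ → ℝ} {s : ℝ} (hs : HasSum h s) :
    HasSum (fun i => if i = 0 then 0 else h (i - 1)) s := by
  rw [← hasSum_nat_add_iff' 1]
  simpa using hs

theorem HasSum.succ {h : ℕ → ℝ} {s : ℝ} (hs : HasSum h s) :
    HasSum (fun i => h (i + 1)) (s - h 0) := by
  simpa using (hasSum_nat_add_iff' 1).2 hs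

theorem Summable.bdd_mul_abs {y b : ℕ → ℝ} {B : ℝ} (hy : Summable fun i => |y i|)
    (hb : ∀ i, |b i| ≤ B) : Summable fun i => b i * y i := by
  refine Summable.of_norm_bounded (hy.mul_left B) fun i => ?_
  rw [Real.norm_eq_abs, abs_mul]
  exact mul_le_mul_of_nonneg_right (hb i) (abs_nonneg _)

/-- The rates of a birth-death-catastrophe process at a fixed time: births at rate `l`, deaths at
rates `m`, catastrophes at rates `c`, with total rates bounded by `L`. -/
structure BDCRates (l : ℝ) (m c : ℕ → ℝ) (L : ℝ) : Prop where
  birth_nonneg : 0 ≤ l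
  death_nonneg : ∀ i, 0 ≤ m i
  catastrophe_nonneg : ∀ i, 0 ≤ c i
  death_zero : m 0 = 0
  catastrophe_zero : c 0 = 0
  le_bound : ∀ i, l + m i + c i ≤ L

/-- The `i`-th coordinate of the forward vector field of a birth-death-catastrophe process. -/
noncomputable def bdcRow (l : ℝ) (m c y : ℕ → ℝ) (i : ℕ) : ℝ :=
  (if i = 0 then 0 else l * y (i - 1)) - (l + m i + c i) * y i + m (i + 1) * y (i + 1) +
    if i = 0 then ∑' j, c j * y j else 0

namespace BDCRates

variable {l : ℝ} {m c : ℕ → ℝ} {L : ℝ} (h : BDCRates l m c L) {y : ℕ → ℝ}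
include h

theorem birth_le : l ≤ L := by
  have := h.le_bound 0
  rw [h.death_zero, h.catastrophe_zero] at this
  linarith

theorem bound_nonneg : 0 ≤ L := h.birth_nonneg.trans h.birth_le

theorem abs_death_le (i : ℕ) : |m i| ≤ L := by
  rw [abs_of_nonneg (h.death_nonneg i)]
  linarith [h.le_bound i, h.birth_nonneg, h.catastrophe_nonneg i]

theorem abs_catastrophe_le (i : ℕ) : |c i| ≤ L := by
  rw [abs_of_nonneg (h.catastrophe_nonneg i)]
  linarith [h.le_bound i, h.birth_nonneg, h.death_nonneg i]

theorem abs_total_le (i : ℕ) : |l + m i + c i| ≤ L := by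
  rw [abs_of_nonneg (by linarith [h.birth_nonneg, h.death_nonneg i, h.catastrophe_nonneg i])]
  exact h.le_bound i

theorem sum_abs_bdcRow_le (hy : Summable fun i => |y i|) (N : ℕ) :
    ∑ i ∈ Finset.range N, |bdcRow l m c y i| ≤ 4 * L * ∑' i, |y i| := by
  have hL := h.bound_nonneg
  have hcat : |∑' j, c j * y j| ≤ L * ∑' i, |y i| := by
    rw [← tsum_mul_left, ← Real.norm_eq_abs]
    refine tsum_of_norm_bounded (hy.mul_left L).hasSum fun i => ?_
    rw [Real.norm_eq_abs, abs_mul]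
    exact mul_le_mul_of_nonneg_right (h.abs_catastrophe_le i) (abs_nonneg _)
  -- Births, outflow, deaths and catastrophes contribute at most L‖y‖ each, whence the factor 4.
  have hs := (((hy.hasSum.mul_left L).pred.add (hy.hasSum.mul_left L)).add
    (hy.hasSum.mul_left L).succ).add (hasSum_ite_eq 0 (L * ∑' i, |y i|))
  have hle : ∀ i, |bdcRow l m c y i| ≤ (if i = 0 then 0 else L * |y (i - 1)|) + L * |y i| +
      L * |y (i + 1)| + if i = 0 then L * ∑' i, |y i| else 0 := by
    intro i
    have h1 : |if i = 0 then 0 else l * y (i - 1)| ≤ if i = 0 then 0 else L * |y (i - 1)| := by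
      split_ifs
      · simp
      · rw [abs_mul, abs_of_nonneg h.birth_nonneg]
        exact mul_le_mul_of_nonneg_right h.birth_le (abs_nonneg _)
    have h2 : |(l + m i + c i) * y i| ≤ L * |y i| := by
      rw [abs_mul]
      exact mul_le_mul_of_nonneg_right (h.abs_total_le i) (abs_nonneg _)
    have h3 : |m (i + 1) * y (i + 1)| ≤ L * |y (i + 1)| := by
      rw [abs_mul]
      exact mul_le_mul_of_nonneg_right (h.abs_death_le _) (abs_nonneg _)
    have h4 : |if i = 0 then ∑' j, c j * y j else 0| ≤ if i = 0 then L * ∑' i, |y i| else 0 := by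
      split_ifs
      · exact hcat
      · simp
    unfold bdcRow
    refine (abs_add_le _ _).trans (add_le_add ((abs_add_le _ _).trans
      (add_le_add ((abs_sub _ _).trans (add_le_add h1 h2)) h3)) h4)
  calc ∑ i ∈ Finset.range N, |bdcRow l m c y i|
      ≤ _ := Finset.sum_le_sum fun i _ => hle i
    _ ≤ _ := sum_le_hasSum _ (fun i _ => (abs_nonneg _).trans (hle i)) hs
    _ ≤ 4 * L * ∑' i, |y i| := by
        have : 0 ≤ L * |y 0| := by positivity
        linarith

theorem summable_abs_bdcRow (hy : Summable fun i => |y i|) :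
    Summable fun i => |bdcRow l m c y i| :=
  summable_of_sum_range_le (fun _ => abs_nonneg _) (h.sum_abs_bdcRow_le hy)

/-- Conservation of mass: whatever leaves a state reappears in a neighbouring row or in row 0. The
death shift loses only the term with `m 0 = 0`. -/
theorem tsum_bdcRow (hy : Summable fun i => |y i|) : ∑' i, bdcRow l m c y i = 0 := by
  have hd := (hy.bdd_mul_abs h.abs_death_le).hasSum
  have hc := (hy.bdd_mul_abs h.abs_catastrophe_le).hasSum
  have hb := hy.of_abs.hasSum.mul_left l
  have ht := (hb.add hd).add hc
  have hs := ((hb.pred.sub ht).add hd.succ).add (hasSum_ite_eq 0 (∑' j, c j * y j))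
  rw [h.death_zero] at hs
  convert hs.tsum_eq using 1
  · refine tsum_congr fun i => ?_
    unfold bdcRow
    ring
  · ring

/-- The weighted column sums of the forward vector field, after subtracting `z` from its first row,
are at most `e * l - z`. -/
theorem tsum_weighted_bdcRow_le {w : ℕ → ℝ} {e z W : ℝ} (hw0 : ∀ i, 0 ≤ w i) (hwW : ∀ i, w i ≤ W)
    (hwm : Monotone w) (hwe : ∀ i, w (i + 1) ≤ (1 + e) * w i) (hz : ∀ i, 1 ≤ i → z ≤ c i)
    (hy : Summable fun i => |y i|) (hzy : z * ∑' i, y i = 0) :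
    ∑' i, w i * (if 0 < y i then bdcRow l m c y i else 0) ≤
      (e * l - z) * ∑' i, w i * max (y i) 0 := by
  set p : ℕ → ℝ := fun i => max (y i) 0 with hp
  have hp0 : ∀ i, 0 ≤ p i := fun i => le_max_right _ _
  have hyp : ∀ i, y i ≤ p i := fun i => le_max_left _ _
  have hps : Summable p := hy.of_nonneg_of_le hp0 fun i => max_le (le_abs_self _) (abs_nonneg _)
  have hpa : Summable fun i => |p i| := hps.abs
  -- Catastrophe coefficients of row 0 after subtracting z ∑ y. Column 0 is kept apart: its
  -- coefficient -z is negative and belongs to the diagonal.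
  set k : ℕ → ℝ := fun i => if i = 0 then 0 else c i - z with hk
  have hk0 : ∀ i, 0 ≤ k i := by
    intro i
    simp only [hk]
    split_ifs with hi
    · exact le_rfl
    · linarith [hz i (Nat.one_le_iff_ne_zero.2 hi)]
  have hkb : ∀ i, |k i| ≤ L + |z| := by
    intro i
    simp only [hk]
    split_ifs
    · simpa using add_nonneg h.bound_nonneg (abs_nonneg z)
    · exact (abs_sub _ _).trans (add_le_add (h.abs_catastrophe_le i) le_rfl)
  have hwa : ∀ i, |w i| ≤ W := fun i => by rw [abs_of_nonneg (hw0 i)]; exact hwW i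
  have hwp : Summable fun i => |w i * p i| := (hpa.bdd_mul_abs hwa).abs
  have hky := (hpa.bdd_mul_abs hkb).hasSum
  -- the catastrophe inflow into state `0`
  have hcat : (if 0 < y 0 then ∑' j, c j * y j else 0) ≤ ∑' j, k j * p j - z * p 0 := by
    split_ifs with hpos
    · have h1 : HasSum (fun j => c j * y j - z * y j) (∑' j, c j * y j) := by
        have := (hy.bdd_mul_abs h.abs_catastrophe_le).hasSum.sub (hy.of_abs.hasSum.mul_left z)
        rwa [hzy, sub_zero] at this
      have h2 := hky.sub (hasSum_ite_eq 0 (z * p 0))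
      refine hasSum_le (fun j => ?_) h1 h2
      rcases eq_or_ne j 0 with rfl | hj
      · have : p 0 = y 0 := max_eq_left hpos.le
        simp [hk, h.catastrophe_zero, this]
      · have := mul_le_mul_of_nonneg_left (hyp j) (hk0 j)
        simp only [hk, if_neg hj] at this ⊢
        linarith
    · have : p 0 = 0 := max_eq_right (not_lt.1 hpos)
      rw [this, mul_zero, sub_zero]
      exact tsum_nonneg fun j => mul_nonneg (hk0 j) (hp0 j)
  have hin := ((hwp.of_abs.hasSum.mul_left ((1 + e) * l)).pred)
  have hd := (hwp.bdd_mul_abs h.abs_death_le).hasSum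
  have ht := (hwp.bdd_mul_abs h.abs_total_le).hasSum
  have hkw := (hwp.bdd_mul_abs hkb).hasSum
  have hs := ((hin.sub ht).add hd.succ).add
    (hasSum_ite_eq 0 (∑' j, k j * (w j * p j) - z * (w 0 * p 0)))
  -- Each inflow is charged to the weight of the state it leaves: births cost a factor 1 + e, deaths
  -- and catastrophes move to a smaller weight. On summation everything cancels against the outflow
  -- except e l - z.
  have hle : ∀ i, w i * (if 0 < y i then bdcRow l m c y i else 0) ≤
      (if i = 0 then 0 else (1 + e) * l * (w (i - 1) * p (i - 1))) -
        (l + m i + c i) * (w i * p i) + m (i + 1) * (w (i + 1) * p (i + 1)) +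
        if i = 0 then ∑' j, k j * (w j * p j) - z * (w 0 * p 0) else 0 := by
    intro i
    have hb : w i * (if i = 0 then 0 else l * p (i - 1)) ≤
        if i = 0 then 0 else (1 + e) * l * (w (i - 1) * p (i - 1)) := by
      split_ifs with hi
      · simp
      · obtain ⟨n, rfl⟩ := Nat.exists_eq_succ_of_ne_zero hi
        simp only [Nat.succ_eq_add_one, Nat.add_sub_cancel]
        have := mul_le_mul_of_nonneg_right (hwe n) (mul_nonneg h.birth_nonneg (hp0 n))
        linarith
    have hm : w i * (m (i + 1) * p (i + 1)) ≤ m (i + 1) * (w (i + 1) * p (i + 1)) := by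
      have := mul_le_mul_of_nonneg_right (hwm (Nat.le_succ i))
        (mul_nonneg (h.death_nonneg (i + 1)) (hp0 (i + 1)))
      simp only [Nat.succ_eq_add_one] at this
      linarith
    have hc : w i * (if i = 0 then (if 0 < y 0 then ∑' j, c j * y j else 0) else 0) ≤
        if i = 0 then ∑' j, k j * (w j * p j) - z * (w 0 * p 0) else 0 := by
      split_ifs with hi hy0
      · subst hi
        rw [if_pos hy0] at hcat
        have h1 := mul_le_mul_of_nonneg_left hcat (hw0 0)
        have h2 : w 0 * ∑' j, k j * p j ≤ ∑' j, k j * (w j * p j) := by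
          refine hasSum_le (fun j => ?_) (hky.mul_left (w 0)) hkw
          have := mul_le_mul_of_nonneg_right (hwm (Nat.zero_le j)) (mul_nonneg (hk0 j) (hp0 j))
          linarith
        linarith
      · subst hi
        have hp00 : p 0 = 0 := max_eq_right (not_lt.1 hy0)
        rw [mul_zero, hp00, mul_zero, mul_zero, sub_zero]
        exact tsum_nonneg fun j => mul_nonneg (hk0 j) (mul_nonneg (hw0 j) (hp0 j))
      · simp
    refine le_trans ?_ (add_le_add (add_le_add (sub_le_sub_right hb _) hm) hc)
    -- Replacing `y` by `p` leaves the diagonal term exact where y_i > 0 and only increases the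
    -- inflows. Elsewhere `p i = 0`, and the right side is a sum of nonnegative inflows.
    have hpart : (if 0 < y i then bdcRow l m c y i else 0) ≤
        (if i = 0 then 0 else l * p (i - 1)) - (l + m i + c i) * p i + m (i + 1) * p (i + 1) +
        (if i = 0 then (if 0 < y 0 then ∑' j, c j * y j else 0) else 0) := by
      have e1 : (if i = 0 then 0 else l * y (i - 1)) ≤ if i = 0 then 0 else l * p (i - 1) := by
        split_ifs
        · exact le_rfl
        · exact mul_le_mul_of_nonneg_left (hyp _) h.birth_nonneg
      have e2 := mul_le_mul_of_nonneg_left (hyp (i + 1)) (h.death_nonneg (i + 1))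
      by_cases hpos : 0 < y i
      · have e3 : p i = y i := max_eq_left hpos.le
        rw [if_pos hpos, bdcRow, e3]
        rcases eq_or_ne i 0 with rfl | hi
        · simp only [if_pos hpos, if_true]
          linarith
        · simp only [if_neg hi] at e1 ⊢
          linarith
      · have e3 : p i = 0 := max_eq_right (not_lt.1 hpos)
        have e4 := mul_nonneg (h.death_nonneg (i + 1)) (hp0 (i + 1))
        have e5 : 0 ≤ if i = 0 then 0 else l * p (i - 1) := by
          split_ifs
          · exact le_rfl
          · exact mul_nonneg h.birth_nonneg (hp0 _)
        rw [if_neg hpos, e3]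
        rcases eq_or_ne i 0 with rfl | hi
        · simp only [if_neg hpos, if_true]
          linarith
        · simp only [if_neg hi] at e5 ⊢
          linarith
    have := mul_le_mul_of_nonneg_left hpart (hw0 i)
    linarith
  have hrow : Summable fun i => w i * (if 0 < y i then bdcRow l m c y i else 0) := by
    refine Summable.of_norm_bounded ((h.summable_abs_bdcRow hy).mul_left W) fun i => ?_
    rw [Real.norm_eq_abs, abs_mul]
    refine mul_le_mul (hwa i) ?_ (abs_nonneg _) ((abs_nonneg _).trans (hwa i))
    split_ifs
    · exact le_rfl
    · simp
  refine (hasSum_le hle hrow.hasSum hs).trans ?_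
  -- Uses c_j = k_j + z for j ≥ 1 and c_0 = k_0 = 0; the last term removes the surplus z in column
  -- 0.
  have htot : ∑' j, (l + m j + c j) * (w j * p j) = l * ∑' j, w j * p j +
      ∑' j, m j * (w j * p j) + ∑' j, k j * (w j * p j) +
        (z * ∑' j, w j * p j - z * (w 0 * p 0)) := by
    have hsum := (((hwp.of_abs.hasSum.mul_left l).add hd).add hkw).add
      ((hwp.of_abs.hasSum.mul_left z).sub (hasSum_ite_eq 0 (z * (w 0 * p 0))))
    rw [← hsum.tsum_eq]
    refine tsum_congr fun j => ?_
    rcases eq_or_ne j 0 with rfl | hj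
    · simp only [hk, h.catastrophe_zero, if_true]
      ring
    · simp only [hk, if_neg hj]
      ring
  rw [htot, h.death_zero]
  linarith

end BDCRates

/-! ### The queue as a birth-death-catastrophe process -/

theorem SeqL1.summable_abs (x : SeqL1) : Summable fun i => |x i| := by
  have := (lp.memℓp x).summable (by simp)
  simpa using this

theorem SeqL1.norm_eq_tsum_abs (x : SeqL1) : ‖x‖ = ∑' i, |x i| := by
  rw [lp.norm_eq_tsum_rpow (by simp)]
  simp

/-- The death rates of the queue at a fixed time, with service intensity `mu`. -/
noncomputable def queueDeath (S : ℕ) (mu : ℝ) (k : ℕ) : ℝ := ((min k S : ℕ) : ℝ) * mu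

/-- The catastrophe rates of the queue at a fixed time, with catastrophe intensity `xi`. -/
noncomputable def queueCatastrophe (zeta : ℕ → ℝ) (xi : ℝ) (k : ℕ) : ℝ :=
  if k = 0 then 0 else zeta k * xi

/-- Rows i ≥ 1 are tridiagonal; row 0 also collects the catastrophes from all states, whose bounded
rates make the series converge on l₁. -/
theorem hasSum_queueMatrix_mul {S : ℕ} {lam mu xi : ℝ → ℝ} {zeta : ℕ → ℝ} {t L : ℝ}
    (h : BDCRates (lam t) (queueDeath S (mu t)) (queueCatastrophe zeta (xi t)) L)
    {y : ℕ → ℝ} (hy : Summable fun i => |y i|) (i : ℕ) :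
    HasSum (fun j => queueMatrix S lam mu zeta xi t i j * y j)
      (bdcRow (lam t) (queueDeath S (mu t)) (queueCatastrophe zeta (xi t)) y i) := by
  have h1 : HasSum (fun j => if i = j + 1 then lam t * y j else 0)
      (if i = 0 then 0 else lam t * y (i - 1)) := by
    rcases i with _ | n
    · simp
    · refine (hasSum_ite_eq n (lam t * y n)).congr_fun fun j => ?_
      grind
  have h2 := hasSum_ite_eq i
    ((lam t + queueDeath S (mu t) i + queueCatastrophe zeta (xi t) i) * y i)
  have h3 := hasSum_ite_eq (i + 1) (queueDeath S (mu t) (i + 1) * y (i + 1))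
  have h4 : HasSum (fun j => if i = 0 then queueCatastrophe zeta (xi t) j * y j else 0)
      (if i = 0 then ∑' j, queueCatastrophe zeta (xi t) j * y j else 0) := by
    split_ifs
    · exact (hy.bdd_mul_abs h.abs_catastrophe_le).hasSum
    · exact hasSum_zero
  refine (((h1.sub h2).add h3).add h4).congr_fun fun j => ?_
  rcases eq_or_ne i j with rfl | hij
  · rcases eq_or_ne i 0 with rfl | hi
    · simp [queueMatrix, bdcMatrix, queueDeath, queueCatastrophe]
    · simp [queueMatrix, bdcMatrix, queueDeath, queueCatastrophe, hi]
      ring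
  · rcases eq_or_ne j (i + 1) with rfl | hj
    · have : i ≠ i + 1 + 1 := by omega
      rcases eq_or_ne i 0 with rfl | hi
      · simp [queueMatrix, bdcMatrix, queueDeath, queueCatastrophe]
        ring
      · simp [queueMatrix, bdcMatrix, queueDeath, hi, this]
    · rcases eq_or_ne i 0 with rfl | hi
      · simp [queueMatrix, bdcMatrix, queueCatastrophe, hij, hij.symm, hj]
      · simp [queueMatrix, bdcMatrix, hij, hij.symm, hj, hi]

/-- The standing assumptions on the intensities of the queue with catastrophes. -/
structure CatastropheQueue (S : ℕ) (lam mu : ℝ → ℝ) (zeta : ℕ → ℝ) (xi : ℝ → ℝ) (z L : ℝ) :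
    Prop where
  rates : ∀ᵐ t, 0 ≤ t →
    BDCRates (lam t) (queueDeath S (mu t)) (queueCatastrophe zeta (xi t)) L
  catastrophe_nonneg : ∀ t, 0 ≤ t → 0 ≤ z * xi t
  le_catastrophe : ∀ t, 0 ≤ t → ∀ i, 1 ≤ i → z * xi t ≤ queueCatastrophe zeta (xi t) i
  arrival_integrable : ∀ t, 0 ≤ t → IntervalIntegrable lam volume 0 t
  catastrophe_integrable : ∀ t, 0 ≤ t → IntervalIntegrable xi volume 0 t

theorem CatastropheQueue.of_bounds {S : ℕ} {lam mu xi : ℝ → ℝ} {zeta : ℕ → ℝ} {z L : ℝ}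
    (hlam : ∀ t, 0 ≤ t → 0 ≤ lam t) (hmu : ∀ t, 0 ≤ t → 0 ≤ mu t) (hxi : ∀ t, 0 ≤ t → 0 ≤ xi t)
    (hlam_int : LocallyIntegrableOn lam (Set.Ici 0))
    (hxi_int : LocallyIntegrableOn xi (Set.Ici 0))
    (hL : ∀ᵐ t ∂(volume.restrict (Set.Ici (0 : ℝ))), ∀ k : ℕ,
      |queueMatrix S lam mu zeta xi t k k| ≤ L)
    (hz : ∀ i, 1 ≤ i → z ≤ zeta i) (hz_pos : 0 < z) :
    CatastropheQueue S lam mu zeta xi z L := by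
  have hint : ∀ f : ℝ → ℝ, LocallyIntegrableOn f (Set.Ici 0) → ∀ t, 0 ≤ t →
      IntervalIntegrable f volume 0 t := by
    intro f hf t ht
    rw [intervalIntegrable_iff_integrableOn_Icc_of_le ht]
    exact hf.integrableOn_compact_subset Set.Icc_subset_Ici_self isCompact_Icc
  refine ⟨?_, fun t ht => mul_nonneg hz_pos.le (hxi t ht), ?_, hint _ hlam_int, hint _ hxi_int⟩
  · rw [ae_restrict_iff' measurableSet_Ici] at hL
    filter_upwards [hL] with t hLt ht
    refine ⟨hlam t ht, fun i => mul_nonneg (Nat.cast_nonneg _) (hmu t ht), fun i => ?_,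
      by simp [queueDeath], by simp [queueCatastrophe], fun i => ?_⟩
    · unfold queueCatastrophe
      split_ifs with hi
      · exact le_rfl
      · exact mul_nonneg (hz_pos.le.trans (hz i (Nat.one_le_iff_ne_zero.2 hi))) (hxi t ht)
    -- The diagonal entry is minus the total exit rate.
    · refine le_trans (le_of_eq ?_) ((neg_le_abs _).trans (hLt ht i))
      rcases eq_or_ne i 0 with rfl | hi
      · simp [queueMatrix, bdcMatrix, queueDeath, queueCatastrophe]
      · simp [queueMatrix, bdcMatrix, queueDeath, queueCatastrophe, hi]
        ring
  · intro t ht i hi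
    rw [queueCatastrophe, if_neg (by omega)]
    exact mul_le_mul_of_nonneg_right (hz i hi) (hxi t ht)

/-! ### Mass conservation and decay of weighted positive parts -/

namespace CatastropheQueue

variable {S : ℕ} {lam mu xi : ℝ → ℝ} {zeta : ℕ → ℝ} {z L : ℝ}
  (h : CatastropheQueue S lam mu zeta xi z L) {x y : ℝ → SeqL1}
include h

theorem isForwardSolution_sub (hx : IsForwardSolution (queueMatrix S lam mu zeta xi) 0 x)
    (hy : IsForwardSolution (queueMatrix S lam mu zeta xi) 0 y) :
    IsForwardSolution (queueMatrix S lam mu zeta xi) 0 (fun t => x t - y t) := by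
  refine ⟨hx.1.sub hy.1, fun t ht i => ?_⟩
  obtain ⟨h1, h2⟩ := hx.2 t ht i
  obtain ⟨h3, h4⟩ := hy.2 t ht i
  have heq : ∀ᵐ τ, τ ∈ Set.uIoc 0 t →
      ∑' j, queueMatrix S lam mu zeta xi τ i j * x τ j -
        ∑' j, queueMatrix S lam mu zeta xi τ i j * y τ j =
      ∑' j, queueMatrix S lam mu zeta xi τ i j * (x τ - y τ) j := by
    filter_upwards [h.rates] with τ hτ hmem
    rw [Set.uIoc_of_le ht] at hmem
    have hr := hτ hmem.1.le
    rw [← (hasSum_queueMatrix_mul hr (x τ).summable_abs i).summable.tsum_sub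
      (hasSum_queueMatrix_mul hr (y τ).summable_abs i).summable]
    exact tsum_congr fun j => by simp [mul_sub]
  refine ⟨(h1.sub h3).congr_ae ?_, ?_⟩
  · rwa [EventuallyEq, ae_restrict_iff' measurableSet_uIoc]
  · rw [← intervalIntegral.integral_congr_ae heq, intervalIntegral.integral_sub h1 h3]
    simp only [lp.coeFn_sub, Pi.sub_apply, h2, h4]
    ring

/-- The norm of `x` is bounded on [0, T] by continuity, and A(t) has l₁ operator bound 4L for almost
every t. This supplies the dominating constant for termwise integration. -/
theorem ae_sum_abs_le (hx : ContinuousOn x (Set.Ici 0)) (T : ℝ) :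
    ∃ B, ∀ᵐ τ, τ ∈ Set.Ioo 0 T → ∀ N, ∑ i ∈ Finset.range N,
      |∑' j, queueMatrix S lam mu zeta xi τ i j * x τ j| ≤ B := by
  obtain ⟨R, hR⟩ := isCompact_Icc.exists_bound_of_continuousOn
    (hx.mono (Set.Icc_subset_Ici_self : Set.Icc 0 T ⊆ Set.Ici 0))
  refine ⟨4 * L * R, ?_⟩
  filter_upwards [h.rates] with τ hτ hmem N
  have hr := hτ hmem.1.le
  have := hr.bound_nonneg
  simp only [(hasSum_queueMatrix_mul hr (x τ).summable_abs _).tsum_eq]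
  refine (hr.sum_abs_bdcRow_le (x τ).summable_abs N).trans ?_
  rw [← SeqL1.norm_eq_tsum_abs]
  gcongr
  exact hR τ (Set.Ioo_subset_Icc_self hmem)

/-- Columns summing to zero, integrated termwise. It carries the zero-mass condition from time 0 to
all later times. -/
theorem tsum_eq (hx : IsForwardSolution (queueMatrix S lam mu zeta xi) 0 x) {T : ℝ} (hT : 0 ≤ T) :
    ∑' i, x T i = ∑' i, x 0 i := by
  obtain ⟨B, hB⟩ := h.ae_sum_abs_le hx.1 T
  have hsum : ∀ᵐ τ, τ ∈ Set.Ioo 0 T →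
      Summable fun i => |∑' j, queueMatrix S lam mu zeta xi τ i j * x τ j| := by
    filter_upwards [hB] with τ hτ hmem
    exact summable_of_sum_range_le (fun _ => abs_nonneg _) (hτ hmem)
  have := (tsum_eq_add_integral_tsum (H := fun i t => x t i) hT
    (fun i => (hx.2 T hT i).1) (fun i => (hx.2 T hT i).2)
    (by filter_upwards [hsum] with τ hτ hmem using (hτ hmem).of_abs)
    (by
      filter_upwards [hB] with τ hτ hmem N
      exact (Finset.abs_sum_le_sum_abs _ _).trans (hτ hmem N))
    (x 0).summable_abs.of_abs (x T).summable_abs.of_abs).2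
  rw [this, add_eq_left]
  refine intervalIntegral.integral_zero_ae ?_
  filter_upwards [h.rates] with τ hτ hmem
  rw [Set.uIoc_of_le hT] at hmem
  have hr := hτ hmem.1.le
  simp only [(hasSum_queueMatrix_mul hr (x τ).summable_abs _).tsum_eq]
  exact hr.tsum_bdcRow (x τ).summable_abs

/-- Decay of the weighted sum of the positive parts of a solution. The parameter `z'` is either `z`,
for solutions of total mass zero, or `0`. -/
theorem tsum_weight_mul_max_le (hx : IsForwardSolution (queueMatrix S lam mu zeta xi) 0 x)
    {w : ℕ → ℝ} {e z' W : ℝ} (hw0 : ∀ i, 0 ≤ w i) (hwW : ∀ i, w i ≤ W) (hwm : Monotone w)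
    (hwe : ∀ i, w (i + 1) ≤ (1 + e) * w i)
    (hz' : ∀ t, 0 ≤ t → ∀ i, 1 ≤ i → z' * xi t ≤ queueCatastrophe zeta (xi t) i)
    (hmass : z' * ∑' i, x 0 i = 0) {T : ℝ} (hT : 0 ≤ T) :
    ∑' i, w i * max (x T i) 0 ≤ (∑' i, w i * max (x 0 i) 0) *
      Real.exp (∫ τ in (0 : ℝ)..T, (e * lam τ - z' * xi τ)) := by
  obtain ⟨B, hB⟩ := h.ae_sum_abs_le hx.1 T
  have hwa : ∀ i, |w i| ≤ W := fun i => by rw [abs_of_nonneg (hw0 i)]; exact hwW i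
  have hW : 0 ≤ W := (hw0 0).trans (hwW 0)
  set f : ℕ → ℝ → ℝ := fun i τ => ∑' j, queueMatrix S lam mu zeta xi τ i j * x τ j with hf
  -- The a.e. derivative of w_i max(x_i, 0).
  set G : ℕ → ℝ → ℝ := fun i τ => w i * (if 0 < x τ i then f i τ else 0) with hG
  have hGf : ∀ i τ, |G i τ| ≤ W * |f i τ| := by
    intro i τ
    simp only [hG]
    rw [abs_mul]
    refine mul_le_mul (hwa i) ?_ (abs_nonneg _) hW
    split_ifs
    · exact le_rfl
    · simp
  have hGB : ∀ᵐ τ, τ ∈ Set.Ioo 0 T → ∀ N, ∑ i ∈ Finset.range N, |G i τ| ≤ W * B := by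
    filter_upwards [hB] with τ hτ hmem N
    calc ∑ i ∈ Finset.range N, |G i τ| ≤ ∑ i ∈ Finset.range N, W * |f i τ| :=
          Finset.sum_le_sum fun i _ => hGf i τ
      _ ≤ W * B := by
          rw [← Finset.mul_sum]
          exact mul_le_mul_of_nonneg_left (hτ hmem N) hW
  have hpos : ∀ i t, 0 ≤ t → IntervalIntegrable (G i) volume 0 t ∧
      w i * max (x t i) 0 = w i * max (x 0 i) 0 + ∫ τ in (0 : ℝ)..t, G i τ := by
    intro i t ht
    obtain ⟨h1, h2⟩ := max_zero_eq_add_integral (x := fun t => x t i) ht (hx.2 t ht i).1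
      fun s hs => (hx.2 s hs.1 i).2
    refine ⟨h1.const_mul (w i), ?_⟩
    rw [h2, mul_add, ← intervalIntegral.integral_const_mul]
  have hsum : ∀ t, Summable fun i => w i * max (x t i) 0 := fun t =>
    Summable.bdd_mul_abs
      ((x t).summable_abs.of_nonneg_of_le (fun _ => abs_nonneg _) fun i => by
        rw [abs_of_nonneg (le_max_right _ _)]
        exact max_le (le_abs_self _) (abs_nonneg _)) hwa
  have hu : ∀ t ∈ Set.Icc 0 T, IntervalIntegrable (fun τ => ∑' i, G i τ) volume 0 t ∧
      ∑' i, w i * max (x t i) 0 = ∑' i, w i * max (x 0 i) 0 +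
        ∫ τ in (0 : ℝ)..t, ∑' i, G i τ := by
    intro t ht
    refine tsum_eq_add_integral_tsum (H := fun i t => w i * max (x t i) 0) (B := W * B) ht.1
      (fun i => (hpos i t ht.1).1) (fun i => (hpos i t ht.1).2) ?_ ?_ (hsum 0) (hsum t)
    · filter_upwards [hGB] with τ hτ hmem
      exact (summable_of_sum_range_le (fun _ => abs_nonneg _)
        (hτ ⟨hmem.1, hmem.2.trans_le ht.2⟩)).of_abs
    · filter_upwards [hGB] with τ hτ hmem N
      exact (Finset.abs_sum_le_sum_abs _ _).trans (hτ ⟨hmem.1, hmem.2.trans_le ht.2⟩ N)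
  refine le_mul_exp_integral (u := fun t => ∑' i, w i * max (x t i) 0) hT
    (hu T ⟨hT, le_rfl⟩).1 (((h.arrival_integrable T hT).const_mul e).sub
      ((h.catastrophe_integrable T hT).const_mul z')) (fun t ht => (hu t ht).2) ?_
  filter_upwards [h.rates] with τ hτ hmem
  have hr := hτ hmem.1.le
  have hz := hz' τ hmem.1.le
  have hmassτ : z' * xi τ * ∑' i, x τ i = 0 := by
    rw [h.tsum_eq hx hmem.1.le]
    linear_combination xi τ * hmass
  have := hr.tsum_weighted_bdcRow_le hw0 hwW hwm hwe hz (x τ).summable_abs hmassτ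
  simpa only [hG, hf, (hasSum_queueMatrix_mul hr (x τ).summable_abs _).tsum_eq] using this

/-- Decay of the geometrically weighted partial sums of the positive parts of a solution whose
initial value is at most the `k`-th unit vector. -/
theorem sum_pow_mul_max_le (hx : IsForwardSolution (queueMatrix S lam mu zeta xi) 0 x)
    {e z' : ℝ} (he : 0 ≤ e)
    (hz' : ∀ t, 0 ≤ t → ∀ i, 1 ≤ i → z' * xi t ≤ queueCatastrophe zeta (xi t) i)
    (hmass : z' * ∑' i, x 0 i = 0) {k : ℕ} (hk : ∀ i, x 0 i ≤ if i = k then 1 else 0)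
    {T : ℝ} (hT : 0 ≤ T) (N : ℕ) :
    ∑ i ∈ Finset.range N, (1 + e) ^ i * max (x T i) 0 ≤ (1 + e) ^ k *
      Real.exp (∫ τ in (0 : ℝ)..T, (e * lam τ - z' * xi τ)) := by
  have h1e : 1 ≤ 1 + e := by linarith
  -- Truncating the exponent makes the weight bounded, hence summable against l₁, and keeps it
  -- monotone with ratio at most 1 + e.
  set w : ℕ → ℝ := fun i => (1 + e) ^ min i N with hw
  have hw0 : ∀ i, 0 ≤ w i := fun i => by positivity
  have hwW : ∀ i, w i ≤ (1 + e) ^ N := fun i => pow_le_pow_right₀ h1e (min_le_right _ _)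
  have hwm : Monotone w := fun i j hij => pow_le_pow_right₀ h1e (min_le_min_right _ hij)
  have hwe : ∀ i, w (i + 1) ≤ (1 + e) * w i := fun i => by
    rw [← pow_succ']
    exact pow_le_pow_right₀ h1e (by omega)
  have key := h.tsum_weight_mul_max_le hx hw0 hwW hwm hwe hz' hmass hT
  have hwa : ∀ i, |w i| ≤ (1 + e) ^ N := fun i => by rw [abs_of_nonneg (hw0 i)]; exact hwW i
  have hsum : ∀ t, Summable fun i => w i * max (x t i) 0 := fun t =>
    Summable.bdd_mul_abs
      ((x t).summable_abs.of_nonneg_of_le (fun _ => abs_nonneg _) fun i => by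
        rw [abs_of_nonneg (le_max_right _ _)]
        exact max_le (le_abs_self _) (abs_nonneg _)) hwa
  calc ∑ i ∈ Finset.range N, (1 + e) ^ i * max (x T i) 0
      = ∑ i ∈ Finset.range N, w i * max (x T i) 0 := by
        refine Finset.sum_congr rfl fun i hi => ?_
        simp only [hw, min_eq_left (Finset.mem_range.1 hi).le]
    _ ≤ ∑' i, w i * max (x T i) 0 :=
        (hsum T).sum_le_tsum _ fun i _ => mul_nonneg (hw0 i) (le_max_right _ _)
    _ ≤ _ := key
    _ ≤ _ := by
        refine mul_le_mul_of_nonneg_right ?_ (Real.exp_pos _).le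
        refine (hasSum_le (fun i => ?_) (hsum 0).hasSum (hasSum_ite_eq k (w k))).trans
          (pow_le_pow_right₀ h1e (min_le_left _ _))
        have := hk i
        split_ifs at this ⊢ with hik
        · subst hik
          have := mul_le_mul_of_nonneg_left (max_le this zero_le_one) (hw0 i)
          linarith
        · rw [max_eq_right this, mul_zero]

/-- Solutions of equal total mass approach each other in norm. -/
theorem norm_sub_le (hx : IsForwardSolution (queueMatrix S lam mu zeta xi) 0 x)
    (hy : IsForwardSolution (queueMatrix S lam mu zeta xi) 0 y)
    (hmass : ∑' i, x 0 i = ∑' i, y 0 i) {T : ℝ} (hT : 0 ≤ T) :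
    ‖x T - y T‖ ≤ ‖x 0 - y 0‖ * Real.exp (-∫ τ in (0 : ℝ)..T, z * xi τ) := by
  have key : ∀ u v : ℝ → SeqL1, IsForwardSolution (queueMatrix S lam mu zeta xi) 0 u →
      IsForwardSolution (queueMatrix S lam mu zeta xi) 0 v → ∑' i, u 0 i = ∑' i, v 0 i →
      ∑' i, max (u T i - v T i) 0 ≤ (∑' i, max (u 0 i - v 0 i) 0) *
        Real.exp (-∫ τ in (0 : ℝ)..T, z * xi τ) := by
    intro u v hu hv huv
    have hmass' : ∑' i, (u 0 - v 0) i = 0 := by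
      simp only [lp.coeFn_sub, Pi.sub_apply]
      rw [(u 0).summable_abs.of_abs.tsum_sub (v 0).summable_abs.of_abs, huv, sub_self]
    have := h.tsum_weight_mul_max_le (h.isForwardSolution_sub hu hv) (w := fun _ => 1) (e := 0)
      (W := 1) (fun _ => zero_le_one) (fun _ => le_rfl) monotone_const (fun _ => by simp)
      h.le_catastrophe (by rw [hmass', mul_zero]) hT
    simpa using this
  -- The norm is the sum of the positive parts of x - y and y - x, and `key` applies to both orders.
  have hsplit : ∀ t, ‖x t - y t‖ =
      ∑' i, max (x t i - y t i) 0 + ∑' i, max (y t i - x t i) 0 := by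
    intro t
    have hs : ∀ f : ℕ → ℝ, (∀ i, |f i| = |(x t - y t) i|) → Summable fun i => max (f i) 0 := by
      intro f hfx
      refine (x t - y t).summable_abs.of_nonneg_of_le (fun _ => le_max_right _ _) fun i => ?_
      rw [← hfx i]
      exact max_le (le_abs_self _) (abs_nonneg _)
    rw [SeqL1.norm_eq_tsum_abs, ← (hs (fun i => x t i - y t i) fun _ => rfl).tsum_add
      (hs (fun i => y t i - x t i) fun _ => abs_sub_comm _ _)]
    refine tsum_congr fun i => ?_
    rw [lp.coeFn_sub, Pi.sub_apply, ← neg_sub (x t i)]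
    exact (posPart_add_negPart (x t i - y t i)).symm
  rw [hsplit T, hsplit 0, add_mul]
  exact add_le_add (key x y hx hy hmass) (key y x hy hx hmass.symm)

end CatastropheQueue

/-! ### State probabilities, means and growth constants -/

theorem IsStochasticVector.tsum_eq_one {x : SeqL1} (hx : IsStochasticVector x) :
    ∑' i, x i = 1 := by
  rw [← hx.2, SeqL1.norm_eq_tsum_abs]
  exact tsum_congr fun i => (abs_of_nonneg (hx.1 i)).symm

theorem isStochasticVector_of_unit {x : SeqL1} {k : ℕ} (hx : ∀ i, x i = if i = k then 1 else 0) :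
    IsStochasticVector x := by
  have h0 : ∀ i, 0 ≤ x i := fun i => by rw [hx]; split_ifs <;> norm_num
  refine ⟨h0, ?_⟩
  rw [SeqL1.norm_eq_tsum_abs, ← tsum_ite_eq k (fun _ => (1 : ℝ))]
  exact tsum_congr fun i => by rw [abs_of_nonneg (h0 i), hx]

theorem integrable_and_integral_eq_of_summable {Ω : Type*} [MeasurableSpace Ω] {P : Measure Ω}
    [IsProbabilityMeasure P] {Y : Ω → ℕ} (hY : Measurable Y)
    (hs : Summable fun i : ℕ => (i : ℝ) * P.real {ω | Y ω = i}) :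
    Integrable (fun ω => (Y ω : ℝ)) P ∧
      ∫ ω, (Y ω : ℝ) ∂P = ∑' i : ℕ, (i : ℝ) * P.real {ω | Y ω = i} := by
  have hmap : ∀ i, (P.map Y).real {i} = P.real {ω | Y ω = i} := fun i => by
    rw [map_measureReal_apply hY (measurableSet_singleton i)]
    rfl
  have := Measure.isProbabilityMeasure_map (μ := P) hY.aemeasurable
  have hint : Integrable (fun n : ℕ => (n : ℝ)) (P.map Y) := by
    rw [← Measure.sum_smul_dirac (P.map Y), integrable_sum_dirac_iff fun i => measure_ne_top _ _]
    refine hs.congr fun i => ?_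
    rw [← hmap, Real.norm_of_nonneg (Nat.cast_nonneg i), mul_comm]
    rfl
  refine ⟨(integrable_map_measure (by fun_prop) hY.aemeasurable).1 hint, ?_⟩
  rw [← integral_map (f := fun n : ℕ => (n : ℝ)) hY.aemeasurable (by fun_prop),
    integral_countable hint]
  exact tsum_congr fun i => by rw [hmap, smul_eq_mul, mul_comm]

/-- The state probabilities of a Markov chain started from `k` solve the forward system. -/
theorem IsMarkovChainWithIntensity.exists_forwardSolution {A : ℝ → ℕ → ℕ → ℝ} {Ω : Type*}
    [MeasurableSpace Ω] {P : Measure Ω} [IsProbabilityMeasure P] {X : ℝ → Ω → ℕ}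
    (hX : IsMarkovChainWithIntensity A P X) {k : ℕ} (hk : ∀ᵐ ω ∂P, X 0 ω = k) :
    ∃ p : ℝ → SeqL1, IsForwardSolution A 0 p ∧ (∀ i, p 0 i = if i = k then 1 else 0) ∧
      ∀ t, 0 ≤ t → ∀ i, stateProb P X t i = p t i := by
  obtain ⟨-, tr, htr, hfdd⟩ := hX
  refine ⟨tr 0 k, (htr 0 le_rfl k).1, (htr 0 le_rfl k).2, fun t ht i => ?_⟩
  -- The joint law at the two times 0 and t; conditioning is vacuous since X(0) = k almost surely.
  have h := hfdd 1 (fun n => if n = 0 then 0 else t) (fun n => if n = 0 then k else i) (by simp)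
    (monotone_nat_of_le_succ fun n => by rcases n with _ | n <;> simp [ht])
  have h1 : P.real {ω | X 0 ω = k} = 1 := by
    rw [measureReal_congr (t := Set.univ), probReal_univ]
    filter_upwards [hk] with ω hω
    exact eq_true hω
  simp only [if_true, h1, one_mul, Finset.prod_range_one, zero_add, one_ne_zero, if_false] at h
  rw [← h]
  refine measureReal_congr ?_
  filter_upwards [hk] with ω hω
  refine propext ⟨fun (hi : X t ω = i) m _ => ?_, fun hall => ?_⟩
  · rcases m with _ | m
    · simpa using hω
    · simpa using hi
  · show X t ω = i
    simpa using hall 1 le_rfl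

theorem bddBelow_growth {d : ℕ → ℝ} (hd : ∀ i, 0 ≤ d i) :
    BddBelow (Set.range fun i : ℕ => d (i + 1) / ((i : ℝ) + 1)) :=
  ⟨0, by rintro _ ⟨i, rfl⟩; exact div_nonneg (hd _) (by positivity)⟩

theorem growthConst_mul_le {d : ℕ → ℝ} (hd : ∀ i, 0 ≤ d i) (i : ℕ) :
    growthConst d * i ≤ d i := by
  rcases i with _ | n
  · simpa using hd 0
  · have := ciInf_le (bddBelow_growth hd) n
    rw [le_div_iff₀ (by positivity)] at this
    simpa [growthConst] using this

theorem growthConst_pow_pred_pos {eps : ℝ} (heps : 0 < eps) :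
    0 < growthConst (fun i => (1 + eps) ^ (i - 1)) := by
  refine (lt_min zero_lt_one heps).trans_le (le_ciInf fun i => ?_)
  simp only [Nat.add_sub_cancel]
  rw [le_div_iff₀ (by positivity)]
  -- By Bernoulli, (1+ε)^i ≥ 1 + iε ≥ min(1, ε)(i + 1).
  have h1 := one_add_mul_le_pow (a := eps) (by linarith) i
  have h2 := min_le_left 1 eps
  have h3 := mul_le_mul_of_nonneg_left (min_le_right 1 eps) (Nat.cast_nonneg (α := ℝ) i)
  linarith

/-- The quotients for the two sequences differ by the factor 1 + ε. This lets a bound with the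
larger constant imply the one with the smaller for every ε. -/
theorem mul_growthConst_pow_pred_le {eps : ℝ} (heps : 0 < eps) :
    (1 + eps) * growthConst (fun i => (1 + eps) ^ (i - 1)) ≤
      growthConst (fun i => (1 + eps) ^ i) := by
  refine le_ciInf fun i => ?_
  simp only [pow_succ', mul_div_assoc]
  refine mul_le_mul_of_nonneg_left ?_ (by positivity)
  exact ciInf_le (bddBelow_growth (d := fun i => (1 + eps) ^ (i - 1)) fun i => by positivity) i

/-! ### Finiteness and comparison of means -/

namespace CatastropheQueue

variable {S : ℕ} {lam mu xi : ℝ → ℝ} {zeta : ℕ → ℝ} {z L : ℝ}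
  (h : CatastropheQueue S lam mu zeta xi z L) {p q : ℝ → SeqL1}
include h

/-- A solution started from a unit vector has finite mean at all times. -/
theorem summable_nat_mul (hp : IsForwardSolution (queueMatrix S lam mu zeta xi) 0 p) {k : ℕ}
    (hk : ∀ i, p 0 i = if i = k then 1 else 0) {t : ℝ} (ht : 0 ≤ t) (hp0 : ∀ i, 0 ≤ p t i) :
    Summable fun i : ℕ => (i : ℝ) * p t i := by
  -- A single solution has mass 1, so no catastrophe decay can be used; growth suffices, and e = 1
  -- gives the weight 2^i ≥ i.
  have hbound := h.sum_pow_mul_max_le hp (e := 1) (z' := 0) zero_le_one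
    (fun s hs i hi => ?_) (zero_mul _) (fun i => (hk i).le) ht
  · refine summable_of_sum_range_le (fun i => mul_nonneg (Nat.cast_nonneg i) (hp0 i)) fun N =>
      (Finset.sum_le_sum fun i _ => ?_).trans (hbound N)
    rw [max_eq_left (hp0 i)]
    refine mul_le_mul_of_nonneg_right ?_ (hp0 i)
    norm_num
    exact_mod_cast Nat.lt_two_pow_self.le
  · rw [zero_mul]
    exact (h.catastrophe_nonneg s hs).trans (h.le_catastrophe s hs i hi)

/-- Upper bound for the difference of the means of two solutions started from unit vectors. -/
theorem growthConst_mul_tsum_sub_le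
    (hp : IsForwardSolution (queueMatrix S lam mu zeta xi) 0 p)
    (hq : IsForwardSolution (queueMatrix S lam mu zeta xi) 0 q) {k m : ℕ}
    (hpk : ∀ i, p 0 i = if i = k then 1 else 0) (hqm : ∀ i, q 0 i = if i = m then 1 else 0)
    {eps t : ℝ} (heps : 0 ≤ eps) (ht : 0 ≤ t) (hps : Summable fun i : ℕ => (i : ℝ) * p t i)
    (hqs : Summable fun i : ℕ => (i : ℝ) * q t i) :
    growthConst (fun i => (1 + eps) ^ i) *
        (∑' i : ℕ, (i : ℝ) * p t i - ∑' i : ℕ, (i : ℝ) * q t i) ≤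
      (1 + eps) ^ k * Real.exp (-∫ τ in (0 : ℝ)..t, (z * xi τ - eps * lam τ)) := by
  have hW : 0 ≤ growthConst (fun i => (1 + eps) ^ i) :=
    Real.iInf_nonneg fun i => by positivity
  have hmass : ∑' i, (p 0 - q 0) i = 0 := by
    simp only [lp.coeFn_sub, Pi.sub_apply]
    rw [(p 0).summable_abs.of_abs.tsum_sub (q 0).summable_abs.of_abs,
      (isStochasticVector_of_unit hpk).tsum_eq_one, (isStochasticVector_of_unit hqm).tsum_eq_one,
      sub_self]
  -- The initial difference e_k - e_m is at most e_k, so only k enters the bound.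
  have hbound := h.sum_pow_mul_max_le (h.isForwardSolution_sub hp hq) heps h.le_catastrophe
    (by rw [hmass, mul_zero]) (k := k) (fun i => by
      rw [lp.coeFn_sub, Pi.sub_apply, hpk, hqm]
      split_ifs <;> norm_num) ht
  rw [← intervalIntegral.integral_neg]
  simp only [neg_sub]
  refine le_of_tendsto ((hps.hasSum.sub hqs.hasSum).mul_left _).tendsto_sum_nat
    (Eventually.of_forall fun N => (Finset.sum_le_sum fun i _ => ?_).trans (hbound N))
  rw [lp.coeFn_sub, Pi.sub_apply, ← mul_sub, ← mul_assoc]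
  have h1 := growthConst_mul_le (d := fun i => (1 + eps) ^ i) (fun i => by positivity) i
  exact (mul_le_mul_of_nonneg_left (le_max_left _ _) (mul_nonneg hW (Nat.cast_nonneg i))).trans
    (mul_le_mul_of_nonneg_right h1 (le_max_right _ _))

end CatastropheQueue

/-! ### The main theorem -/

theorem theorem2 (S : ℕ) (lam mu xi : ℝ → ℝ) (zeta : ℕ → ℝ) (z eps L : ℝ)
    -- nonnegative locally integrable intensities, essentially bounded intensity matrix
    (hlam : ∀ t, 0 ≤ t → 0 ≤ lam t) (hmu : ∀ t, 0 ≤ t → 0 ≤ mu t) (hxi : ∀ t, 0 ≤ t → 0 ≤ xi t)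
    (hlam_int : LocallyIntegrableOn lam (Set.Ici 0))
    (hmu_int : LocallyIntegrableOn mu (Set.Ici 0))
    (hxi_int : LocallyIntegrableOn xi (Set.Ici 0))
    (hL : ∀ᵐ t ∂(volume.restrict (Set.Ici (0 : ℝ))), ∀ k : ℕ,
      |queueMatrix S lam mu zeta xi t k k| ≤ L)
    -- large catastrophe rates
    (hz : IsGLB (zeta '' Set.Ici 1) z) (hz_pos : 0 < z) (heps : 0 < eps)
    (hlarge : Tendsto (fun T : ℝ => ∫ t in (0 : ℝ)..T, (z * xi t - eps * lam t)) atTop atTop)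
    -- the queue-length process, started from `X(0) = k` under `P k`
    {Ω : Type*} [MeasurableSpace Ω] (P : ℕ → Measure Ω) [∀ k, IsProbabilityMeasure (P k)]
    (X : ℝ → Ω → ℕ)
    (hX : ∀ k, IsMarkovChainWithIntensity (queueMatrix S lam mu zeta xi) (P k) X)
    (hX_zero : ∀ k, ∀ᵐ ω ∂(P k), X 0 ω = k) :
    IsWeaklyErgodic (queueMatrix S lam mu zeta xi) ∧
    (∀ k t, 0 ≤ t → Integrable (fun ω => (X t ω : ℝ)) (P k)) ∧
    IsLimitingMean (fun k t => meanAt (P k) X t) (fun t => meanAt (P 0) X t) ∧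
    (∀ k t, 0 ≤ t →
      ∑' i, |stateProb (P k) X t i - stateProb (P 0) X t i| ≤
        4 * (1 + eps) ^ k * eps⁻¹ *
          Real.exp (-∫ τ in (0 : ℝ)..t, (z * xi τ - eps * lam τ))) ∧
    (∀ k t, 0 ≤ t →
      |meanAt (P k) X t - meanAt (P 0) X t| ≤
        4 * (1 + eps) ^ k / (eps * growthConst (fun i => (1 + eps) ^ (i - 1))) *
          Real.exp (-∫ τ in (0 : ℝ)..t, (z * xi τ - eps * lam τ))) ∧
    (eps ≤ 4 → ∀ k t, 0 ≤ t →
      |meanAt (P k) X t - meanAt (P 0) X t| ≤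
        4 * (1 + eps) ^ k / (eps * growthConst (fun i => (1 + eps) ^ i)) *
          Real.exp (-∫ τ in (0 : ℝ)..t, (z * xi τ - eps * lam τ))) := by
  have hz_le : ∀ i, 1 ≤ i → z ≤ zeta i := fun i hi => hz.1 ⟨i, hi, rfl⟩
  have h := CatastropheQueue.of_bounds (mu := mu) (S := S) hlam hmu hxi hlam_int hxi_int hL hz_le
    hz_pos
  choose p hp hp0 hpst using fun k => (hX k).exists_forwardSolution (hX_zero k)
  have hexp : ∀ t, 0 ≤ t → Real.exp (-∫ τ in (0 : ℝ)..t, z * xi τ) ≤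
      Real.exp (-∫ τ in (0 : ℝ)..t, (z * xi τ - eps * lam τ)) := by
    intro t ht
    rw [intervalIntegral.integral_sub ((h.catastrophe_integrable t ht).const_mul z)
      ((h.arrival_integrable t ht).const_mul eps)]
    have : 0 ≤ ∫ τ in (0 : ℝ)..t, eps * lam τ :=
      intervalIntegral.integral_nonneg ht fun τ hτ => mul_nonneg heps.le (hlam τ hτ.1)
    exact Real.exp_le_exp.2 (by linarith)
  have hexp_lim : Tendsto (fun t : ℝ => Real.exp (-∫ τ in (0 : ℝ)..t, (z * xi τ - eps * lam τ)))
      atTop (𝓝 0) := Real.tendsto_exp_neg_atTop_nhds_zero.comp hlarge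
  have hnn : ∀ k t, 0 ≤ t → ∀ i, 0 ≤ p k t i := fun k t ht i => by
    rw [← hpst k t ht i]
    exact measureReal_nonneg
  have hsummable := fun k t ht => h.summable_nat_mul (hp k) (hp0 k) (t := t) ht (hnn k t ht)
  have hmean : ∀ k t, 0 ≤ t → Integrable (fun ω => (X t ω : ℝ)) (P k) ∧
      meanAt (P k) X t = ∑' i : ℕ, (i : ℝ) * p k t i := by
    intro k t ht
    have hst : ∀ i, (P k).real {ω | X t ω = i} = p k t i := hpst k t ht
    have := integrable_and_integral_eq_of_summable (P := P k) ((hX k).1 t ht) (by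
      simp only [hst]
      exact hsummable k t ht)
    simp only [hst] at this
    exact this
  set W := growthConst (fun i => (1 + eps) ^ (i - 1)) with hW
  set W' := growthConst (fun i => (1 + eps) ^ i) with hW'
  have hWpos : 0 < W := growthConst_pow_pred_pos heps
  have hWW' : (1 + eps) * W ≤ W' := mul_growthConst_pow_pred_le heps
  have hW'pos : 0 < W' := lt_of_lt_of_le (by positivity) hWW'
  -- The constant 1/W' replaces 4/(ε W) here. The opposite order of the two solutions has the factor
  -- (1+ε)^0 ≤ (1+ε)^k.
  have hdiff : ∀ k t, 0 ≤ t → |meanAt (P k) X t - meanAt (P 0) X t| ≤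
      (1 + eps) ^ k / W' * Real.exp (-∫ τ in (0 : ℝ)..t, (z * xi τ - eps * lam τ)) := by
    intro k t ht
    have h1 := h.growthConst_mul_tsum_sub_le (hp k) (hp 0) (hp0 k) (hp0 0) heps.le ht
      (hsummable k t ht) (hsummable 0 t ht)
    have h2 := h.growthConst_mul_tsum_sub_le (hp 0) (hp k) (hp0 0) (hp0 k) heps.le ht
      (hsummable 0 t ht) (hsummable k t ht)
    have h3 : (1 + eps) ^ 0 * Real.exp (-∫ τ in (0 : ℝ)..t, (z * xi τ - eps * lam τ)) ≤
        (1 + eps) ^ k * Real.exp (-∫ τ in (0 : ℝ)..t, (z * xi τ - eps * lam τ)) := by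
      gcongr
      · linarith
      · exact Nat.zero_le k
    rw [(hmean k t ht).2, (hmean 0 t ht).2, div_mul_eq_mul_div, le_div_iff₀ hW'pos,
      mul_comm]
    rcases abs_cases (∑' i : ℕ, (i : ℝ) * p k t i - ∑' i : ℕ, (i : ℝ) * p 0 t i) with
      ⟨he, -⟩ | ⟨he, -⟩
    · rw [he]
      exact h1
    · rw [he, neg_sub]
      exact h2.trans h3
  -- The condition says 1/W' ≤ 4/(ε V). It always holds for V = W, as (1+ε) W ≤ W', and for V = W'
  -- it amounts to ε ≤ 4.
  have hdiff_of_le : ∀ V, 0 < V → eps * V ≤ 4 * W' → ∀ k t, 0 ≤ t →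
      |meanAt (P k) X t - meanAt (P 0) X t| ≤ 4 * (1 + eps) ^ k / (eps * V) *
        Real.exp (-∫ τ in (0 : ℝ)..t, (z * xi τ - eps * lam τ)) := by
    intro V hV hVW k t ht
    refine (hdiff k t ht).trans (mul_le_mul_of_nonneg_right ?_ (Real.exp_pos _).le)
    rw [div_le_div_iff₀ hW'pos (by positivity)]
    have := mul_le_mul_of_nonneg_left hVW (by positivity : 0 ≤ (1 + eps) ^ k)
    linarith
  refine ⟨?_, fun k t ht => (hmean k t ht).1, ?_, ?_, ?_, ?_⟩
  · intro x y hx hy hx0 hy0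
    refine squeeze_zero' (Eventually.of_forall fun t => norm_nonneg _) ?_
      (by simpa using hexp_lim.const_mul ‖x 0 - y 0‖)
    filter_upwards [eventually_ge_atTop 0] with t ht
    refine (h.norm_sub_le hx hy (hx0.tsum_eq_one.trans hy0.tsum_eq_one.symm) ht).trans ?_
    exact mul_le_mul_of_nonneg_left (hexp t ht) (norm_nonneg _)
  · intro k
    refine squeeze_zero_norm' ?_ (by simpa using hexp_lim.const_mul ((1 + eps) ^ k / W'))
    filter_upwards [eventually_ge_atTop 0] with t ht
    rw [Real.norm_eq_abs, abs_sub_comm]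
    exact hdiff k t ht
  · intro k t ht
    have hstoch := fun k => isStochasticVector_of_unit (hp0 k)
    have h1 : ∑' i, |stateProb (P k) X t i - stateProb (P 0) X t i| = ‖p k t - p 0 t‖ := by
      rw [SeqL1.norm_eq_tsum_abs]
      exact tsum_congr fun i => by rw [hpst k t ht, hpst 0 t ht, lp.coeFn_sub, Pi.sub_apply]
    have h2 := h.norm_sub_le (hp k) (hp 0)
      ((hstoch k).tsum_eq_one.trans (hstoch 0).tsum_eq_one.symm) ht
    rw [h1]
    refine h2.trans (mul_le_mul ?_ (hexp t ht) (Real.exp_pos _).le (by positivity))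
    -- For k = 0 the factor 4/ε may be below 2, but the initial difference vanishes. For positive
    -- exponents (1+ε)^k ≥ ε, so the trivial bound 2 suffices.
    rcases k with _ | k
    · rw [sub_self, norm_zero]
      positivity
    · have h3 : ‖p (k + 1) 0 - p 0 0‖ ≤ 2 := by
        refine (_root_.norm_sub_le _ _).trans ?_
        rw [(hstoch (k + 1)).2, (hstoch 0).2]
        norm_num
      refine h3.trans ?_
      rw [← div_eq_mul_inv, le_div_iff₀ heps]
      have h4 : 1 ≤ (1 + eps) ^ k := one_le_pow₀ (by linarith)
      have h5 := mul_le_mul_of_nonneg_left h4 (by linarith : 0 ≤ 1 + eps)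
      rw [pow_succ']
      linarith
  · refine hdiff_of_le W hWpos ?_
    have : 0 < eps * W := by positivity
    linarith
  · intro heps4
    exact hdiff_of_le W' hW'pos (mul_le_mul_of_nonneg_right heps4 hW'pos.le)
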